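/- All graphs are finite, simple and undirected, and $d_G$ denotes the shortest-path distance. Let $G$ be a connected graph. A set $X\subseteq V(G)$ resolves two vertices $u,v$ if $d_G(u,x)\neq d_G(v,x)$ for some $x\in X$. The metric dimension $\dim(G)$ is the smallest cardinality of a set $X\subseteq V(G)$ that resolves every pair of distinct vertices of $G$, and the nonlocal metric dimension $\dim_{\mathrm{n}\ell}(G)$ is the smallest cardinality of a set $X\subseteq V(G)$ that resolves every pair of distinct non-adjacent vertices of $G$. A block of $G$ is a maximal connected subgraph that has no cut-vertex of its own; $G$ is a block graph if it is connected and each of its blocks is a complete graph. The block-cutpoint tree $\widehat{G}$ of $G$ is the tree whose vertices are the blocks and the cut-vertices of $G$, where a block $B$ is adjacent to a cut-vertex $v$ if and only if $v\in V(B)$, and there are no other edges. Theorem. If $G$ is a block graph with at least $3$ vertices, then $$\dim_{\mathrm{n}\ell}(G)=\dim(\widehat{G}).$$ -/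

import Mathlib

namespace SimpleGraph

/-- `X` resolves `u` and `v` if some `x ∈ X` has different distances to `u` and `v`. -/
def Resolves {V : Type*} (G : SimpleGraph V) (X : Finset V) (u v : V) : Prop :=
  ∃ x ∈ X, G.dist u x ≠ G.dist v x

/-- A resolving set resolves every pair of distinct vertices. -/
def IsResolvingSet {V : Type*} (G : SimpleGraph V) (X : Finset V) : Prop :=
  ∀ u v : V, u ≠ v → G.Resolves X u v

/-- A nonlocal resolving set resolves every pair of distinct non-adjacent vertices. -/
def IsNonlocalResolvingSet {V : Type*} (G : SimpleGraph V) (X : Finset V) : Prop :=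
  ∀ u v : V, u ≠ v → ¬ G.Adj u v → G.Resolves X u v

/-- The metric dimension: the smallest cardinality of a resolving set. For a finite connected
graph the set of all vertices is resolving, so the infimum is attained. -/
noncomputable def metricDim {V : Type*} (G : SimpleGraph V) : ℕ :=
  sInf {k : ℕ | ∃ X : Finset V, X.card = k ∧ G.IsResolvingSet X}

/-- The nonlocal metric dimension: the smallest cardinality of a nonlocal resolving set. -/
noncomputable def nonlocalMetricDim {V : Type*} (G : SimpleGraph V) : ℕ :=
  sInf {k : ℕ | ∃ X : Finset V, X.card = k ∧ G.IsNonlocalResolvingSet X}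

/-- A cut-vertex: its deletion separates two other vertices of the same component, that is,
it increases the number of components. -/
def IsCutVertex {V : Type*} (G : SimpleGraph V) (v : V) : Prop :=
  ∃ a b : ({v}ᶜ : Set V), G.Reachable a b ∧ ¬ (G.induce ({v}ᶜ : Set V)).Reachable a b

/-- A block: a maximal connected subgraph that has no cut-vertex of its own. Adding edges on
the same vertices destroys neither property, so blocks are induced subgraphs and are given
here by their vertex sets. -/
def IsBlock {V : Type*} (G : SimpleGraph V) (B : Set V) : Prop :=
  Maximal (fun S : Set V => (G.induce S).Connected ∧ ∀ v : S, ¬ (G.induce S).IsCutVertex v) B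

/-- A block graph: a connected graph all of whose blocks are complete. -/
def IsBlockGraph {V : Type*} (G : SimpleGraph V) : Prop :=
  G.Connected ∧ ∀ B : Set V, G.IsBlock B → G.IsClique B

/-- The block-cutpoint tree: its vertices are the blocks and the cut-vertices of `G`, and a
block `B` is adjacent to a cut-vertex `v` if `v ∈ B`. -/
def blockCutpointTree {V : Type*} (G : SimpleGraph V) :
    SimpleGraph ({B : Set V // G.IsBlock B} ⊕ {v : V // G.IsCutVertex v}) where
  Adj
    | Sum.inl B, Sum.inr v => v.1 ∈ B.1
    | Sum.inr v, Sum.inl B => v.1 ∈ B.1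
    | Sum.inl _, Sum.inl _ => False
    | Sum.inr _, Sum.inr _ => False
  symm := ⟨by rintro (_ | _) (_ | _) h <;> exact h⟩
  loopless := ⟨by rintro (_ | _) h <;> exact h⟩

end SimpleGraph

/-!
Seen from a vertex `x`, each block `B` of a block graph has a unique nearest vertex, its gate `g`,
and the other vertices of `B` are at distance `d(g, x) + 1` from `x`. Hence, up to a shift depending
on `x` only, the distance in the block-cutpoint tree to the vertex standing for `x` is `2 d(c, x)`
at a cut-vertex `c` and `2 d(g, x) + 1` at the block `B`.

A set `X` is nonlocal resolving if and only if any two blocks have gates at different distances from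
some `x ∈ X`. Given two blocks, take in each a vertex that is not the gate towards the other: these
two vertices are not adjacent, and they are as far from `x` as each other if the gates are.
Conversely, two vertices that are not adjacent are resolved by any `x` that distinguishes the block
through which each of them sees the other. So `X` is nonlocal resolving if and only if the tree
vertices standing for `X` resolve the tree.

A tree vertex standing for no vertex of `G` is a block consisting of cut-vertices. In a resolving
set of a tree, a vertex `y` with at least two neighbours can be traded for one of these: some `r`
in the set tells two neighbours apart, so it is closer to `y` than to one of them, `c`, and then
`r` and `c` together resolve every pair that `y` resolves.
-/

namespace BlockGraph

open SimpleGraph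

variable {V : Type*} {G : SimpleGraph V}

theorem exists_adj_dist_add_one_eq (hG : G.Connected) {u v : V} (huv : u ≠ v) :
    ∃ w, G.Adj u w ∧ G.dist w v + 1 = G.dist u v := by
  obtain ⟨p, hp⟩ := hG.exists_walk_length_eq_dist u v
  cases p with
  | nil => exact absurd rfl huv
  | @cons _ w _ huw p =>
    have hlt : G.dist u v ≤ G.dist u w + G.dist w v := hG.dist_triangle
    have hle : G.dist w v ≤ p.length := dist_le p
    rw [dist_eq_one_iff_adj.2 huw] at hlt
    rw [Walk.length_cons] at hp
    exact ⟨w, huw, by omega⟩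

/-! ### Nonseparable sets and blocks -/

theorem isCutVertex_iff (hG : G.Preconnected) {v : V} :
    G.IsCutVertex v ↔ ¬ (G.induce {v}ᶜ).Preconnected := by
  simp only [IsCutVertex, Preconnected, not_forall, hG _ _, true_and]

/-- A set of vertices that induces a connected subgraph without a cut-vertex of its own. Blocks are
the maximal sets of this kind. -/
def IsNonseparable (G : SimpleGraph V) (S : Set V) : Prop :=
  (G.induce S).Connected ∧ ∀ v ∈ S, (G.induce (S \ {v})).Preconnected

theorem isBlock_iff_maximal {B : Set V} : G.IsBlock B ↔ Maximal (IsNonseparable G) B := by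
  have iso (S : Set V) (v : S) : (G.induce S).induce {v}ᶜ ≃g G.induce (S \ {v.1}) :=
    { toFun z := ⟨z.1.1, z.1.2, fun h => z.2 (Subtype.ext h)⟩
      invFun z := ⟨⟨z.1, z.2.1⟩, fun h => z.2.2 (congrArg Subtype.val h)⟩
      map_rel_iff' := Iff.rfl }
  have key (S : Set V) : ((G.induce S).Connected ∧ ∀ v : S, ¬ (G.induce S).IsCutVertex v) ↔
      IsNonseparable G S := by
    refine and_congr_right fun hS => ?_
    simp only [isCutVertex_iff hS.preconnected, not_not, (iso S _).preconnected_iff,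
      Subtype.forall]
  simp only [IsBlock, key]

theorem preconnected_induce_of_patches {S : Set V}
    (h : ∀ a ∈ S, ∀ b ∈ S, ∃ T ⊆ S, a ∈ T ∧ b ∈ T ∧ (G.induce T).Preconnected) :
    (G.induce S).Preconnected := by
  rintro ⟨a, ha⟩ ⟨b, hb⟩
  obtain ⟨T, hTS, haT, hbT, hT⟩ := h a ha b hb
  exact (hT ⟨a, haT⟩ ⟨b, hbT⟩).map (G.induceHomOfLE hTS).toHom

theorem IsNonseparable.preconnected_sdiff {S : Set V} (hS : IsNonseparable G S) (v : V) :
    (G.induce (S \ {v})).Preconnected := by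
  by_cases hv : v ∈ S
  · exact hS.2 v hv
  · rw [Set.sdiff_singleton_eq_self hv]
    exact hS.1.preconnected

theorem IsNonseparable.of_isClique {S : Set V} (hS : G.IsClique S) (hne : S.Nonempty) :
    IsNonseparable G S := by
  have key {T : Set V} (hT : T ⊆ S) : (G.induce T).Preconnected := by
    rintro ⟨a, ha⟩ ⟨b, hb⟩
    obtain rfl | hab := eq_or_ne a b
    · rfl
    · exact Adj.reachable (hS (hT ha) (hT hb) hab)
  exact ⟨(connected_iff _).2 ⟨key subset_rfl, hne.to_subtype⟩, fun _ _ => key Set.sdiff_subset⟩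

theorem support_sdiff_singleton_of_isCycle {v : V} {c : G.Walk v v} (hc : c.IsCycle) :
    {z | z ∈ c.support} \ {v} = {z | z ∈ c.tail.dropLast.support} := by
  have htail : ¬ c.tail.Nil := fun h => (c.adj_snd hc.not_nil).ne h.eq.symm
  have hsupp : v :: (c.tail.dropLast.support ++ [v]) = c.support := by
    rw [Walk.support_dropLast_concat htail, Walk.cons_support_tail hc.not_nil]
  have hv : v ∉ c.tail.dropLast.support := by
    have hnodup := hc.isPath_tail.support_nodup
    rw [← Walk.support_dropLast_concat htail] at hnodup
    exact fun h => List.disjoint_of_nodup_append hnodup h (List.mem_singleton_self v)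
  ext z
  simp only [← hsupp, Set.mem_sdiff, Set.mem_ofPred_eq, List.mem_cons, List.mem_append,
    Set.mem_singleton_iff]
  grind

theorem IsNonseparable.of_isCycle {u : V} {c : G.Walk u u} (hc : c.IsCycle) :
    IsNonseparable G {z | z ∈ c.support} := by
  classical
  refine ⟨c.connected_induce_support, fun v hv => ?_⟩
  have hrotate : {z | z ∈ c.support} = {z | z ∈ (c.rotate v hv).support} := by
    ext z
    exact (Walk.mem_support_rotate_iff ..).symm
  rw [hrotate, support_sdiff_singleton_of_isCycle (hc.rotate hv)]
  exact (Walk.connected_induce_support _).preconnected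

theorem IsNonseparable.union {S T : Set V} (hS : IsNonseparable G S) (hT : IsNonseparable G T)
    (hST : (S ∩ T).Nontrivial) : IsNonseparable G (S ∪ T) := by
  refine ⟨induce_union_connected hS.1.preconnected hT.1.preconnected hST.nonempty, fun v _ => ?_⟩
  obtain ⟨u, hu, huv⟩ := hST.exists_ne v
  rw [Set.union_sdiff_distrib]
  exact (induce_union_connected (hS.preconnected_sdiff v) (hT.preconnected_sdiff v)
    ⟨u, ⟨hu.1, huv⟩, ⟨hu.2, huv⟩⟩).preconnected

theorem IsNonseparable.sUnion_of_isChain {c : Set (Set V)} (hc : IsChain (· ⊆ ·) c)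
    (hne : c.Nonempty) (h : ∀ S ∈ c, IsNonseparable G S) : IsNonseparable G (⋃₀ c) := by
  have cover {a b : V} (ha : a ∈ ⋃₀ c) (hb : b ∈ ⋃₀ c) : ∃ S ∈ c, a ∈ S ∧ b ∈ S := by
    obtain ⟨S, hS, haS⟩ := ha
    obtain ⟨T, hT, hbT⟩ := hb
    obtain hST | hTS := hc.total hS hT
    · exact ⟨T, hT, hST haS, hbT⟩
    · exact ⟨S, hS, haS, hTS hbT⟩
  refine ⟨(connected_iff _).2 ⟨preconnected_induce_of_patches fun a ha b hb => ?_, ?_⟩,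
    fun v _ => preconnected_induce_of_patches fun a ha b hb => ?_⟩
  · obtain ⟨S, hS, haS, hbS⟩ := cover ha hb
    exact ⟨S, Set.subset_sUnion_of_mem hS, haS, hbS, (h S hS).1.preconnected⟩
  · obtain ⟨S, hS⟩ := hne
    exact ((Set.nonempty_coe_sort.1 (h S hS).1.nonempty).mono
      (Set.subset_sUnion_of_mem hS)).to_subtype
  · obtain ⟨S, hS, haS, hbS⟩ := cover ha.1 hb.1
    exact ⟨S \ {v}, Set.sdiff_subset_sdiff_left (Set.subset_sUnion_of_mem hS), ⟨haS, ha.2⟩,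
      ⟨hbS, hb.2⟩, (h S hS).preconnected_sdiff v⟩

theorem IsNonseparable.exists_isBlock_superset {S : Set V} (hS : IsNonseparable G S) :
    ∃ B, S ⊆ B ∧ G.IsBlock B := by
  simp only [isBlock_iff_maximal]
  exact zorn_subset_nonempty {T | IsNonseparable G T}
    (fun c hcS hc hne => ⟨⋃₀ c, .sUnion_of_isChain hc hne hcS, fun _ => Set.subset_sUnion_of_mem⟩)
    S hS

theorem exists_isBlock_mem (G : SimpleGraph V) (v : V) : ∃ B, G.IsBlock B ∧ v ∈ B := by
  obtain ⟨B, hvB, hB⟩ := (IsNonseparable.of_isClique (G := G) (isClique_singleton v)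
    (Set.singleton_nonempty v)).exists_isBlock_superset
  exact ⟨B, hB, Set.singleton_subset_iff.1 hvB⟩

theorem exists_isBlock_of_adj {u v : V} (h : G.Adj u v) : ∃ B, G.IsBlock B ∧ u ∈ B ∧ v ∈ B := by
  obtain ⟨B, huvB, hB⟩ := (IsNonseparable.of_isClique (isClique_pair.2 fun _ => h)
    (Set.insert_nonempty u {v})).exists_isBlock_superset
  exact ⟨B, hB, Set.pair_subset_iff.1 huvB⟩

theorem nonempty_of_isBlock {B : Set V} (hB : G.IsBlock B) : B.Nonempty :=
  Set.nonempty_coe_sort.1 hB.prop.1.nonempty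

theorem subset_of_isBlock_of_inter_nontrivial {B S : Set V} (hB : G.IsBlock B)
    (hS : IsNonseparable G S) (hBS : (B ∩ S).Nontrivial) : S ⊆ B := by
  rw [isBlock_iff_maximal] at hB
  exact Set.subset_union_right.trans (hB.le_of_ge (hB.prop.union hS hBS) Set.subset_union_left)

theorem eq_of_isBlock_of_inter_nontrivial {B C : Set V} (hB : G.IsBlock B) (hC : G.IsBlock C)
    (hBC : (B ∩ C).Nontrivial) : B = C :=
  (subset_of_isBlock_of_inter_nontrivial hC (isBlock_iff_maximal.1 hB).prop
    (by rwa [Set.inter_comm])).antisymm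
  (subset_of_isBlock_of_inter_nontrivial hB (isBlock_iff_maximal.1 hC).prop hBC)

theorem nontrivial_of_isBlock [Nontrivial V] (hG : G.Preconnected) {B : Set V} (hB : G.IsBlock B) :
    B.Nontrivial := by
  obtain ⟨b, hb⟩ := nonempty_of_isBlock hB
  obtain ⟨w, hbw⟩ := hG.exists_adj_of_nontrivial b
  obtain ⟨C, hC, hbC, hwC⟩ := exists_isBlock_of_adj hbw
  by_contra hBt
  have hBb : B = {b} := (Set.not_nontrivial_iff.1 hBt).eq_singleton_of_mem hb
  have hCB : C ⊆ B := hB.le_of_ge hC.prop (hBb ▸ Set.singleton_subset_iff.2 hbC)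
  exact hBt ⟨b, hb, w, hCB hwC, hbw.ne⟩

theorem exists_adj_reachable_induce_compl (hG : G.Preconnected) {v : V} (a : ({v}ᶜ : Set V)) :
    ∃ w : ({v}ᶜ : Set V), G.Adj v w ∧ (G.induce {v}ᶜ).Reachable a w := by
  obtain ⟨a, ha⟩ := a
  obtain ⟨p⟩ := hG a v
  induction p with
  | nil => exact absurd rfl ha
  | @cons a b v hab p ih =>
    by_cases hb : b = v
    · exact ⟨⟨a, ha⟩, hb ▸ hab.symm, .rfl⟩
    · obtain ⟨w, hvw, hbw⟩ := ih hb
      have hab' : (G.induce {v}ᶜ).Adj ⟨a, ha⟩ ⟨b, hb⟩ := hab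
      exact ⟨w, hvw, hab'.reachable.trans hbw⟩

theorem exists_isBlock_ne_of_isCutVertex (hG : G.Preconnected) {v : V} (hv : G.IsCutVertex v)
    {B : Set V} (hB : G.IsBlock B) : ∃ C, G.IsBlock C ∧ C ≠ B ∧ v ∈ C := by
  by_contra! hunique
  have neighbor_mem {w : V} (hvw : G.Adj v w) : w ∈ B := by
    obtain ⟨C, hC, hvC, hwC⟩ := exists_isBlock_of_adj hvw
    by_contra hwB
    exact hunique C hC (fun h => hwB (h ▸ hwC)) hvC
  rw [isCutVertex_iff hG] at hv
  refine hv fun a b => ?_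
  obtain ⟨a', hva', haa'⟩ := exists_adj_reachable_induce_compl hG a
  obtain ⟨b', hvb', hbb'⟩ := exists_adj_reachable_induce_compl hG b
  have hab' : (G.induce {v}ᶜ).Reachable a' b' :=
    ((isBlock_iff_maximal.1 hB).prop.preconnected_sdiff v ⟨a', neighbor_mem hva', a'.2⟩
      ⟨b', neighbor_mem hvb', b'.2⟩).map (G.induceHomOfLE fun _ hz => hz.2).toHom
  exact haa'.trans (hab'.trans hbb'.symm)

theorem nontrivial_of_isBlock_ne {B C : Set V} (hB : G.IsBlock B) (hC : G.IsBlock C)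
    (hBC : B ≠ C) : Nontrivial V := by
  by_contra hV
  rw [not_nontrivial_iff_subsingleton] at hV
  exact hBC ((Subsingleton.eq_univ_of_nonempty (nonempty_of_isBlock hB)).trans
    (Subsingleton.eq_univ_of_nonempty (nonempty_of_isBlock hC)).symm)

/-! ### Gates -/

/-- The vertex of the block `B` through which `z` is attached to `B`: the one in the component of
`z` after deleting the edges inside `B`. It exists and is unique if `G` is a block graph, see
`gate_mem`, `reachable_gate` and `gate_eq`. -/
noncomputable def gate (G : SimpleGraph V) (B : Set V) (z : V) : V :=
  haveI : Nonempty V := ⟨z⟩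
  Classical.epsilon fun g => g ∈ B ∧ (G.deleteEdges B.sym2).Reachable g z

theorem gate_mem_and_reachable (hG : G.Connected) {B : Set V} (hB : G.IsBlock B) (z : V) :
    gate G B z ∈ B ∧ (G.deleteEdges B.sym2).Reachable (gate G B z) z := by
  refine Classical.epsilon_spec (p := fun g => g ∈ B ∧ (G.deleteEdges B.sym2).Reachable g z) ?_
  obtain ⟨b, hb⟩ := nonempty_of_isBlock hB
  obtain ⟨p⟩ := hG.preconnected z b
  induction p with
  | nil => exact ⟨_, hb, .rfl⟩
  | @cons z w _ hzw _ ih =>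
    obtain ⟨g, hgB, hgw⟩ := ih hb
    by_cases hin : s(z, w) ∈ B.sym2
    · exact ⟨z, hin.1, .rfl⟩
    · exact ⟨g, hgB, hgw.trans (deleteEdges_adj.2 ⟨hzw, hin⟩).symm.reachable⟩

theorem gate_mem (hG : G.Connected) {B : Set V} (hB : G.IsBlock B) (z : V) : gate G B z ∈ B :=
  (gate_mem_and_reachable hG hB z).1

theorem reachable_gate (hG : G.Connected) {B : Set V} (hB : G.IsBlock B) (z : V) :
    (G.deleteEdges B.sym2).Reachable (gate G B z) z :=
  (gate_mem_and_reachable hG hB z).2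

section Gate

variable (hG : G.IsBlockGraph) {B C : Set V} (hB : G.IsBlock B)

include hG hB

theorem not_reachable_deleteEdges_sym2 {u v : V} (hu : u ∈ B) (hv : v ∈ B) (huv : u ≠ v) :
    ¬ (G.deleteEdges B.sym2).Reachable u v := by
  intro h
  obtain ⟨p, hp⟩ := h.exists_isPath
  let q : G.Walk u v := p.mapLe (G.deleteEdges_le _)
  have hcycle : (Walk.cons (hG.2 B hB hv hu huv.symm) q).IsCycle := by
    refine (Walk.cons_isCycle_iff _ _).2 ⟨hp.mapLe _, fun hmem => ?_⟩
    rw [Walk.edges_mapLe_eq_edges] at hmem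
    exact (deleteEdges_adj.1 (p.adj_of_mem_edges hmem)).2 ⟨hv, hu⟩
  have hsupport : {z | z ∈ p.support} ⊆ B := by
    refine subset_trans (fun z hz => ?_) (subset_of_isBlock_of_inter_nontrivial hB
      (.of_isCycle hcycle) ⟨u, ⟨hu, by simp⟩, v, ⟨hv, by simp⟩, huv⟩)
    simpa [q] using .inr hz
  have hnil : ¬ p.Nil := fun h => huv h.eq
  exact (deleteEdges_adj.1 (p.adj_snd hnil)).2 ⟨hu, hsupport (p.getVert_mem_support 1)⟩

theorem gate_eq {g z : V} (hg : g ∈ B) (hgz : (G.deleteEdges B.sym2).Reachable g z) :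
    gate G B z = g := by
  by_contra hne
  exact not_reachable_deleteEdges_sym2 hG hB (gate_mem hG.1 hB z) hg hne
    ((reachable_gate hG.1 hB z).trans hgz.symm)

theorem gate_of_mem {b : V} (hb : b ∈ B) : gate G B b = b :=
  gate_eq hG hB hb .rfl

theorem gate_eq_of_adj {z w : V} (hzw : G.Adj z w) (hout : s(z, w) ∉ B.sym2) :
    gate G B z = gate G B w :=
  gate_eq hG hB (gate_mem hG.1 hB w)
    ((reachable_gate hG.1 hB w).trans (deleteEdges_adj.2 ⟨hzw, hout⟩).symm.reachable)

theorem gate_eq_of_mem_isBlock (hC : G.IsBlock C) (hBC : B ≠ C) {y z : V} (hy : y ∈ C)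
    (hz : z ∈ C) : gate G B y = gate G B z := by
  obtain rfl | hyz := eq_or_ne y z
  · rfl
  · exact gate_eq_of_adj hG hB (hG.2 C hC hy hz hyz) fun hin =>
      hBC (eq_of_isBlock_of_inter_nontrivial hB hC ⟨y, ⟨hin.1, hy⟩, z, ⟨hin.2, hz⟩, hyz⟩)

theorem dist_gate_lt_length {x y : V} (p : G.Walk x y) (hxy : gate G B x ≠ gate G B y) :
    G.dist (gate G B x) x < p.length := by
  induction p with
  | nil => exact absurd rfl hxy
  | @cons x w y hxw p ih =>
    rw [Walk.length_cons]
    by_cases hin : s(x, w) ∈ B.sym2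
    · simp [gate_of_mem hG hB hin.1]
    · rw [gate_eq_of_adj hG hB hxw hin] at hxy ⊢
      calc G.dist (gate G B w) x ≤ G.dist (gate G B w) w + G.dist w x := hG.1.dist_triangle
        _ < p.length + 1 := by
          rw [dist_eq_one_iff_adj.2 hxw.symm]
          exact Nat.add_lt_add_right (ih hxy) 1

theorem dist_gate_lt {x y : V} (hxy : gate G B x ≠ gate G B y) :
    G.dist (gate G B x) x < G.dist y x := by
  obtain ⟨p, hp⟩ := hG.1.exists_walk_length_eq_dist x y
  rw [dist_comm (u := y), ← hp]
  exact dist_gate_lt_length hG hB p hxy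

theorem dist_of_mem_of_gate_ne {x y : V} (hy : y ∈ B) (hxy : gate G B x ≠ y) :
    G.dist y x = G.dist (gate G B x) x + 1 := by
  have hlt : G.dist (gate G B x) x < G.dist y x :=
    dist_gate_lt hG hB (by rwa [gate_of_mem hG hB hy])
  have hle : G.dist y x ≤ G.dist y (gate G B x) + G.dist (gate G B x) x := hG.1.dist_triangle
  rw [dist_eq_one_iff_adj.2 (hG.2 B hB hy (gate_mem hG.1 hB x) hxy.symm)] at hle
  omega

theorem isCutVertex_gate {x : V} (hx : gate G B x ≠ x) : G.IsCutVertex (gate G B x) := by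
  have : Nontrivial V := ⟨_, _, hx⟩
  obtain ⟨b, hb, hbx⟩ := (nontrivial_of_isBlock hG.1.preconnected hB).exists_ne (gate G B x)
  refine (isCutVertex_iff hG.1.preconnected).2 fun hconn => ?_
  obtain ⟨p⟩ := hconn ⟨x, hx.symm⟩ ⟨b, hbx⟩
  obtain ⟨⟨⟨z, w⟩, hzw⟩, -, hz, hw⟩ := p.exists_boundary_dart {z | gate G B z = gate G B x} rfl
    (by rwa [Set.mem_ofPred_eq, gate_of_mem hG hB hb])
  have hin : s(z.1, w.1) ∈ B.sym2 := by
    by_contra hout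
    exact hw ((gate_eq_of_adj hG hB hzw hout).symm.trans hz)
  exact z.2 ((gate_of_mem hG hB hin.1).symm.trans hz)

theorem isCutVertex_of_mem_of_mem (hC : G.IsBlock C) (hBC : B ≠ C) {v : V} (hvB : v ∈ B)
    (hvC : v ∈ C) : G.IsCutVertex v := by
  have : Nontrivial V := nontrivial_of_isBlock_ne hB hC hBC
  obtain ⟨c, hc, hcv⟩ := (nontrivial_of_isBlock hG.1.preconnected hC).exists_ne v
  have hgate : gate G B c = v :=
    (gate_eq_of_mem_isBlock hG hB hC hBC hc hvC).trans (gate_of_mem hG hB hvB)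
  exact hgate ▸ isCutVertex_gate hG hB (hgate ▸ hcv.symm)

theorem gate_eq_of_dist_gate_le (hC : G.IsBlock C) (hBC : B ≠ C) {x y : V}
    (hle : G.dist (gate G C x) x ≤ G.dist (gate G B x) x) (hy : y ∈ C) :
    gate G B x = gate G B y := by
  by_contra hne
  rw [gate_eq_of_mem_isBlock hG hB hC hBC hy (gate_mem hG.1 hC x)] at hne
  exact (dist_gate_lt hG hB hne).not_ge hle

theorem gate_eq_of_gate_ne (hC : G.IsBlock C) (hBC : B ≠ C) {c x : V} (hcB : c ∈ B)
    (hcC : c ∈ C) (hx : gate G B x ≠ c) : gate G C x = c := by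
  obtain hle | hle := le_total (G.dist (gate G C x) x) (G.dist (gate G B x) x)
  · refine absurd ?_ hx
    rw [gate_eq_of_dist_gate_le hG hB hC hBC hle hcC, gate_of_mem hG hB hcB]
  · rw [gate_eq_of_dist_gate_le hG hC hB hBC.symm hle hcB, gate_of_mem hG hC hcC]

omit hB

theorem exists_isBlock_gate_ne {c x : V} (hcx : c ≠ x) :
    ∃ B, G.IsBlock B ∧ c ∈ B ∧ gate G B x ≠ c := by
  obtain ⟨w, hcw, hw⟩ := exists_adj_dist_add_one_eq hG.1 hcx
  obtain ⟨B, hB, hc, hwB⟩ := exists_isBlock_of_adj hcw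
  refine ⟨B, hB, hc, fun hgate => ?_⟩
  have hdist := dist_of_mem_of_gate_ne hG hB hwB (x := x) (hgate.trans_ne hcw.ne)
  rw [hgate] at hdist
  omega

theorem exists_dist_gate_ne_of_isNonlocalResolvingSet (hB : G.IsBlock B) (hC : G.IsBlock C)
    {X : Finset V} (hX : G.IsNonlocalResolvingSet X) (hBC : B ≠ C) :
    ∃ x ∈ X, G.dist (gate G B x) x ≠ G.dist (gate G C x) x := by
  have : Nontrivial V := nontrivial_of_isBlock_ne hB hC hBC
  obtain ⟨b₀, hb₀⟩ := nonempty_of_isBlock hB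
  obtain ⟨c₀, hc₀⟩ := nonempty_of_isBlock hC
  obtain ⟨b, hb, hb_gate⟩ := (nontrivial_of_isBlock hG.1.preconnected hB).exists_ne (gate G B c₀)
  obtain ⟨c, hc, hc_gate⟩ := (nontrivial_of_isBlock hG.1.preconnected hC).exists_ne (gate G C b₀)
  have gate_B {y : V} (hy : y ∈ C) : gate G B y ≠ b :=
    (gate_eq_of_mem_isBlock hG hB hC hBC hy hc₀).trans_ne hb_gate.symm
  have gate_C {y : V} (hy : y ∈ B) : gate G C y ≠ c :=
    (gate_eq_of_mem_isBlock hG hC hB hBC.symm hy hb₀).trans_ne hc_gate.symm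
  have hcB : c ∉ B := fun h => gate_C h (gate_of_mem hG hC hc)
  have hbc : b ≠ c := fun h => hcB (h ▸ hb)
  have hadj : ¬ G.Adj b c := fun h =>
    gate_B hc ((gate_eq_of_adj hG hB h fun hin => hcB hin.2).symm.trans (gate_of_mem hG hB hb))
  obtain ⟨x, hxX, hx⟩ := hX b c hbc hadj
  refine ⟨x, hxX, fun heq => hx ?_⟩
  have hgateB : gate G B x ≠ b :=
    (gate_eq_of_dist_gate_le hG hB hC hBC heq.ge hc).trans_ne (gate_B hc)
  have hgateC : gate G C x ≠ c :=
    (gate_eq_of_dist_gate_le hG hC hB hBC.symm heq.le hb).trans_ne (gate_C hb)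
  rw [dist_of_mem_of_gate_ne hG hB hb hgateB, dist_of_mem_of_gate_ne hG hC hc hgateC, heq]

theorem isNonlocalResolvingSet_of_exists_dist_gate_ne {X : Finset V}
    (hX : ∀ B C, G.IsBlock B → G.IsBlock C → B ≠ C →
      ∃ x ∈ X, G.dist (gate G B x) x ≠ G.dist (gate G C x) x) :
    G.IsNonlocalResolvingSet X := by
  intro u v huv hadj
  obtain ⟨B, hB, huB, hgateB⟩ := exists_isBlock_gate_ne hG huv
  obtain ⟨C, hC, hvC, hgateC⟩ := exists_isBlock_gate_ne hG huv.symm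
  have hBC : B ≠ C := by
    rintro rfl
    exact hadj (hG.2 B hB huB hvC huv)
  obtain ⟨x, hxX, hx⟩ := hX B C hB hC hBC
  refine ⟨x, hxX, ?_⟩
  by_cases hBx : gate G B x = u
  · have hlt := dist_gate_lt hG hB (x := x) (y := v) (hBx.trans_ne hgateB.symm)
    exact (hBx ▸ hlt).ne
  by_cases hCx : gate G C x = v
  · have hlt := dist_gate_lt hG hC (x := x) (y := u) (hCx.trans_ne hgateC.symm)
    exact (hCx ▸ hlt).ne'
  rw [dist_of_mem_of_gate_ne hG hB huB hBx, dist_of_mem_of_gate_ne hG hC hvC hCx]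
  omega

theorem isNonlocalResolvingSet_iff_forall_isBlock {X : Finset V} :
    G.IsNonlocalResolvingSet X ↔ ∀ B C, G.IsBlock B → G.IsBlock C → B ≠ C →
      ∃ x ∈ X, G.dist (gate G B x) x ≠ G.dist (gate G C x) x :=
  ⟨fun hX _ _ hB hC hBC => exists_dist_gate_ne_of_isNonlocalResolvingSet hG hB hC hX hBC,
    isNonlocalResolvingSet_of_exists_dist_gate_ne hG⟩

end Gate

/-! ### Trees -/

section Tree

variable {W : Type*} {T : SimpleGraph W}

theorem le_length_add_of_adj {f : W → ℕ} (hf : ∀ a b, T.Adj a b → f a ≤ f b + 1) {a b : W}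
    (p : T.Walk a b) : f a ≤ p.length + f b := by
  induction p with
  | nil => simp
  | cons h p ih =>
    have := hf _ _ h
    rw [Walk.length_cons]
    omega

theorem exists_walk_length_add_eq {f : W → ℕ} {t₀ : W}
    (hdesc : ∀ t, t ≠ t₀ → ∃ s, T.Adj t s ∧ f s + 1 = f t) (t : W) :
    ∃ p : T.Walk t t₀, p.length + f t₀ = f t := by
  induction hn : f t using Nat.strong_induction_on generalizing t with
  | _ n ih =>
    obtain rfl | ht := eq_or_ne t t₀
    · exact ⟨.nil, by simp [hn]⟩
    · obtain ⟨s, hts, hs⟩ := hdesc t ht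
      obtain ⟨p, hp⟩ := ih (f s) (by omega) s rfl
      exact ⟨.cons hts p, by rw [Walk.length_cons]; omega⟩

theorem reachable_and_dist_add_eq {f : W → ℕ} {t₀ : W} (hf : ∀ a b, T.Adj a b → f a ≤ f b + 1)
    (hdesc : ∀ t, t ≠ t₀ → ∃ s, T.Adj t s ∧ f s + 1 = f t) (t : W) :
    T.Reachable t t₀ ∧ T.dist t t₀ + f t₀ = f t := by
  obtain ⟨p, hp⟩ := exists_walk_length_add_eq hdesc t
  obtain ⟨q, hq⟩ := p.reachable.exists_walk_length_eq_dist
  have hdist : T.dist t t₀ ≤ p.length := dist_le p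
  have hheight : f t ≤ q.length + f t₀ := le_length_add_of_adj hf q
  exact ⟨p.reachable, by omega⟩

theorem isAcyclic_of_unique_lower_neighbor {f : W → ℕ} (hne : ∀ a b, T.Adj a b → f a ≠ f b)
    (hunique : ∀ t a b, T.Adj t a → T.Adj t b → f a < f t → f b < f t → a = b) :
    T.IsAcyclic := by
  classical
  intro u c hc
  obtain ⟨m, hm, hmax⟩ := c.support.toFinset.exists_max_image f ⟨u, by simp⟩
  rw [List.mem_toFinset] at hm
  have hd := hc.rotate hm
  set d := c.rotate m hm
  have lower {z : W} (hmz : T.Adj m z) (hz : z ∈ d.support) : f z < f m :=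
    lt_of_le_of_ne (hmax z (List.mem_toFinset.2 ((Walk.mem_support_rotate_iff ..).1 hz)))
      (hne _ _ hmz).symm
  have hsnd : T.Adj m d.snd := d.adj_snd hd.not_nil
  have hpen : T.Adj m d.penultimate := (d.adj_penultimate hd.not_nil).symm
  exact hd.snd_ne_penultimate (hunique m _ _ hsnd hpen (lower hsnd (d.getVert_mem_support _))
    (lower hpen (d.getVert_mem_support _)))

theorem length_eq_dist_of_isPath (hT : T.IsAcyclic) {u v : W} {p : T.Walk u v} (hp : p.IsPath) :
    p.length = T.dist u v := by
  obtain ⟨q, hq, hlength⟩ := p.reachable.exists_path_of_dist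
  rw [← hlength]
  exact congrArg (fun r : T.Path u v => r.1.length)
    ((hT.subsingleton_path u v).elim ⟨p, hp⟩ ⟨q, hq⟩)

theorem dist_eq_add_of_adj (hT : T.IsTree) {v c y r : W} (hcy : T.Adj c y)
    (hv : T.dist v y = T.dist v c + 1) (hr : T.dist c r = T.dist y r + 1) :
    T.dist v r = T.dist v c + 1 + T.dist y r := by
  obtain ⟨p, hp⟩ := hT.1.exists_walk_length_eq_dist v c
  obtain ⟨q, hq⟩ := hT.1.exists_walk_length_eq_dist y r
  have hp' : (p.concat hcy).IsPath := Walk.isPath_of_length_eq_dist _ (by simp [hp, hv])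
  have hq' : (Walk.cons hcy q).IsPath := Walk.isPath_of_length_eq_dist _ (by simp [hq, hr])
  have hpq : (p.append (.cons hcy q)).IsPath := by
    rw [hT.2.isPath_iff_isChain] at hp' hq' ⊢
    rw [Walk.edges_append, Walk.edges_cons, List.isChain_split]
    rw [Walk.edges_concat, List.concat_eq_append] at hp'
    exact ⟨hp', hq'⟩
  rw [← length_eq_dist_of_isPath hT.2 hpq, Walk.length_append, Walk.length_cons, hp, hq]
  omega

theorem dist_eq_or_of_adj (hT : T.IsTree) (x : W) {a b : W} (hab : T.Adj a b) :
    T.dist a x = T.dist b x + 1 ∨ T.dist b x = T.dist a x + 1 := by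
  simpa only [dist_comm] using hT.dist_eq_dist_add_one_of_adj x hab

theorem resolves_symm {X : Finset W} {u v : W} (h : T.Resolves X u v) : T.Resolves X v u :=
  h.imp fun _ => And.imp_right Ne.symm

/-- `r` detects on which side of the edge `c y` a vertex lies, and `c` replaces `y` on each side. -/
theorem resolves_of_dist_lt (hT : T.IsTree) {X : Finset W} {c y r : W} (hcy : T.Adj c y)
    (hcX : c ∈ X) (hrX : r ∈ X) (hr : T.dist c r = T.dist y r + 1) {u v : W}
    (huv : T.dist u y < T.dist v y) : T.Resolves X u v := by
  by_contra hres
  simp only [Resolves, not_exists, not_and, not_not] at hres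
  have hc : T.dist u c = T.dist v c := hres c hcX
  have hu := hT.dist_eq_dist_add_one_of_adj u hcy
  have hv := hT.dist_eq_dist_add_one_of_adj v hcy
  have hur : T.dist u r ≤ T.dist u y + T.dist y r := hT.1.dist_triangle
  have hvr : T.dist v r = T.dist v c + 1 + T.dist y r := dist_eq_add_of_adj hT hcy (by omega) hr
  have hr : T.dist u r = T.dist v r := hres r hrX
  omega

theorem exists_adj_isResolvingSet_insert_erase [DecidableEq W] (hT : T.IsTree) {Y : Finset W}
    (hY : T.IsResolvingSet Y) {y : W} (hy : (T.neighborSet y).Nontrivial) :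
    ∃ c, T.Adj y c ∧ T.IsResolvingSet (insert c (Y.erase y)) := by
  obtain ⟨c₁, h₁, c₂, h₂, h₁₂⟩ := hy
  obtain ⟨r, hrY, hr⟩ := hY c₁ c₂ h₁₂
  have hry : r ≠ y := by
    rintro rfl
    exact hr ((dist_eq_one_iff_adj.2 h₁.symm).trans (dist_eq_one_iff_adj.2 h₂.symm).symm)
  obtain ⟨c, hyc, hcr⟩ : ∃ c, T.Adj y c ∧ T.dist c r = T.dist y r + 1 := by
    obtain h₁r | h₁r := dist_eq_or_of_adj hT r h₁
    · refine ⟨c₂, h₂, (dist_eq_or_of_adj hT r h₂).resolve_left fun h₂r => hr ?_⟩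
      omega
    · exact ⟨c₁, h₁, h₁r⟩
  have hrX : r ∈ insert c (Y.erase y) :=
    Finset.mem_insert_of_mem (Finset.mem_erase.2 ⟨hry, hrY⟩)
  refine ⟨c, hyc, fun u v huv => ?_⟩
  obtain ⟨x, hxY, hx⟩ := hY u v huv
  obtain rfl | hxy := eq_or_ne x y
  · obtain huv | hvu := lt_or_gt_of_ne hx
    · exact resolves_of_dist_lt hT hyc.symm (Finset.mem_insert_self ..) hrX hcr huv
    · exact resolves_symm
        (resolves_of_dist_lt hT hyc.symm (Finset.mem_insert_self ..) hrX hcr hvu)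
  · exact ⟨x, Finset.mem_insert_of_mem (Finset.mem_erase.2 ⟨hxy, hxY⟩), hx⟩

theorem exists_isResolvingSet_subset (hT : T.IsTree) {R : Set W}
    (hR : ∀ y ∉ R, (T.neighborSet y).Nontrivial ∧ T.neighborSet y ⊆ R) {Y : Finset W}
    (hY : T.IsResolvingSet Y) :
    ∃ Z : Finset W, ↑Z ⊆ R ∧ Z.card ≤ Y.card ∧ T.IsResolvingSet Z := by
  classical
  induction hn : (Y.filter (· ∉ R)).card using Nat.strong_induction_on generalizing Y with
  | _ n ih =>
    by_cases hYR : ↑Y ⊆ R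
    · exact ⟨Y, hYR, le_rfl, hY⟩
    obtain ⟨y, hyY, hyR⟩ := Set.not_subset.1 hYR
    obtain ⟨c, hyc, hc⟩ := exists_adj_isResolvingSet_insert_erase hT hY (hR y hyR).1
    have hlt : ((insert c (Y.erase y)).filter (· ∉ R)).card < n := by
      rw [Finset.filter_insert, if_neg (not_not.2 ((hR y hyR).2 hyc)), Finset.filter_erase, ← hn]
      exact Finset.card_erase_lt_of_mem (Finset.mem_filter.2 ⟨hyY, hyR⟩)
    obtain ⟨Z, hZR, hcard, hZ⟩ := ih _ hlt hc rfl
    refine ⟨Z, hZR, hcard.trans ((Finset.card_insert_le _ _).trans_eq ?_), hZ⟩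
    exact Finset.card_erase_add_one hyY

end Tree

/-! ### The block-cutpoint tree -/

/-- The vertices of the block-cutpoint tree. -/
abbrev TreeVertex (G : SimpleGraph V) : Type _ :=
  {B : Set V // G.IsBlock B} ⊕ {v : V // G.IsCutVertex v}

open Classical in
/-- The vertex of the block-cutpoint tree that stands for the vertex `v` of `G`: a cut-vertex stands
for itself, any other vertex is replaced by the block that contains it. -/
noncomputable def toTree (G : SimpleGraph V) (v : V) : TreeVertex G :=
  if hv : G.IsCutVertex v then .inr ⟨v, hv⟩
  else .inl ⟨(exists_isBlock_mem G v).choose, (exists_isBlock_mem G v).choose_spec.1⟩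

/-- The distance of a tree vertex to the vertex `x` of `G`, doubled since a step in `G` is two steps
in the tree, where the block `B` is one step further away than its gate. Up to a shift depending on
`x` only, it is the distance to `toTree G x`, see `reachable_toTree_and_dist_add`. -/
noncomputable def height (G : SimpleGraph V) (x : V) : TreeVertex G → ℕ
  | .inl B => 2 * G.dist (gate G B.1 x) x + 1
  | .inr c => 2 * G.dist c.1 x

theorem toTree_of_isCutVertex {v : V} (hv : G.IsCutVertex v) : toTree G v = .inr ⟨v, hv⟩ :=
  dif_pos hv

theorem toTree_of_not_isCutVertex (hG : G.IsBlockGraph) {v : V} (hv : ¬ G.IsCutVertex v)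
    {B : Set V} (hB : G.IsBlock B) (hvB : v ∈ B) : toTree G v = .inl ⟨B, hB⟩ := by
  obtain ⟨hC, hvC⟩ := (exists_isBlock_mem G v).choose_spec
  rw [toTree, dif_neg hv]
  congr 2
  by_contra hCB
  exact hv (isCutVertex_of_mem_of_mem hG hC hB hCB hvC hvB)

theorem height_add_one_of_gate_eq {B : {B : Set V // G.IsBlock B}}
    {c : {v : V // G.IsCutVertex v}} {x : V} (hgate : gate G B.1 x = c.1) :
    height G x (.inr c) + 1 = height G x (.inl B) := by
  simp only [height, hgate]

theorem height_add_one_of_gate_ne (hG : G.IsBlockGraph) {B : {B : Set V // G.IsBlock B}}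
    {c : {v : V // G.IsCutVertex v}} {x : V} (hcB : c.1 ∈ B.1) (hgate : gate G B.1 x ≠ c.1) :
    height G x (.inl B) + 1 = height G x (.inr c) := by
  simp only [height, dist_of_mem_of_gate_ne hG B.2 hcB hgate]
  omega

theorem height_of_adj (hG : G.IsBlockGraph) (x : V) {s t : TreeVertex G}
    (hst : G.blockCutpointTree.Adj s t) :
    height G x s + 1 = height G x t ∨ height G x t + 1 = height G x s := by
  have key {B : {B : Set V // G.IsBlock B}} {c : {v : V // G.IsCutVertex v}} (hcB : c.1 ∈ B.1) :
      height G x (.inr c) + 1 = height G x (.inl B) ∨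
        height G x (.inl B) + 1 = height G x (.inr c) :=
    (eq_or_ne (gate G B.1 x) c.1).imp height_add_one_of_gate_eq (height_add_one_of_gate_ne hG hcB)
  match s, t, hst with
  | .inl _, .inr _, hcB => exact (key hcB).symm
  | .inr _, .inl _, hcB => exact key hcB

theorem exists_adj_height_add_one_eq (hG : G.IsBlockGraph) {x : V} {t : TreeVertex G}
    (ht : t ≠ toTree G x) :
    ∃ s, G.blockCutpointTree.Adj t s ∧ height G x s + 1 = height G x t := by
  match t, ht with
  | .inl B, ht =>
    have hcut : G.IsCutVertex (gate G B.1 x) := by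
      by_contra hcut
      have hx : gate G B.1 x = x := not_not.1 fun hne => hcut (isCutVertex_gate hG B.2 hne)
      rw [hx] at hcut
      exact ht (toTree_of_not_isCutVertex hG hcut B.2 (hx ▸ gate_mem hG.1 B.2 x)).symm
    exact ⟨.inr ⟨_, hcut⟩, gate_mem hG.1 B.2 x, height_add_one_of_gate_eq rfl⟩
  | .inr c, ht =>
    have hcx : c.1 ≠ x := by
      rintro rfl
      exact ht (toTree_of_isCutVertex c.2).symm
    obtain ⟨B, hB, hcB, hgate⟩ := exists_isBlock_gate_ne hG hcx
    exact ⟨.inl ⟨B, hB⟩, hcB, height_add_one_of_gate_ne hG hcB hgate⟩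

theorem reachable_toTree_and_dist_add (hG : G.IsBlockGraph) (x : V) (t : TreeVertex G) :
    G.blockCutpointTree.Reachable t (toTree G x) ∧
      G.blockCutpointTree.dist t (toTree G x) + height G x (toTree G x) = height G x t := by
  refine reachable_and_dist_add_eq (fun a b hab => ?_)
    (fun _ ht => exists_adj_height_add_one_eq hG ht) t
  have := height_of_adj hG x hab
  omega

theorem dist_toTree_eq_iff (hG : G.IsBlockGraph) (x : V) (s t : TreeVertex G) :
    G.blockCutpointTree.dist s (toTree G x) = G.blockCutpointTree.dist t (toTree G x) ↔
      height G x s = height G x t := by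
  have hs := (reachable_toTree_and_dist_add hG x s).2
  have ht := (reachable_toTree_and_dist_add hG x t).2
  omega

theorem gate_eq_of_height_lt (hG : G.IsBlockGraph) {B : {B : Set V // G.IsBlock B}}
    {c : {v : V // G.IsCutVertex v}} {x : V} (hcB : c.1 ∈ B.1)
    (hlt : height G x (.inr c) < height G x (.inl B)) : gate G B.1 x = c.1 := by
  by_contra hgate
  have := height_add_one_of_gate_ne hG hcB hgate
  omega

theorem gate_ne_of_height_lt {B : {B : Set V // G.IsBlock B}} {c : {v : V // G.IsCutVertex v}}
    {x : V} (hlt : height G x (.inl B) < height G x (.inr c)) : gate G B.1 x ≠ c.1 := by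
  intro hgate
  have := height_add_one_of_gate_eq hgate
  omega

theorem isTree_blockCutpointTree (hG : G.IsBlockGraph) : G.blockCutpointTree.IsTree := by
  obtain ⟨x⟩ := hG.1.nonempty
  refine ⟨(connected_iff _).2 ⟨fun s t => ?_, ⟨toTree G x⟩⟩,
    isAcyclic_of_unique_lower_neighbor (f := height G x) (fun a b hab => ?_) ?_⟩
  · exact (reachable_toTree_and_dist_add hG x s).1.trans
      (reachable_toTree_and_dist_add hG x t).1.symm
  · have := height_of_adj hG x hab
    omega
  · rintro (B | c) (C | d) (D | e) hC hD hlower hlower' <;> try contradiction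
    · exact congrArg Sum.inr (Subtype.ext
        ((gate_eq_of_height_lt hG hC hlower).symm.trans (gate_eq_of_height_lt hG hD hlower')))
    · refine congrArg Sum.inl (Subtype.ext (not_not.1 fun hne => ?_))
      exact gate_ne_of_height_lt hlower'
        (gate_eq_of_gate_ne hG C.2 D.2 hne hC hD (gate_ne_of_height_lt hlower))

/-! ### Resolving sets -/

theorem exists_height_inl_ne (hG : G.IsBlockGraph) {X : Finset V}
    (hX : G.IsNonlocalResolvingSet X) {B C : {B : Set V // G.IsBlock B}} (hBC : B ≠ C) :
    ∃ x ∈ X, height G x (.inl B) ≠ height G x (.inl C) := by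
  obtain ⟨x, hxX, hx⟩ := (isNonlocalResolvingSet_iff_forall_isBlock hG).1 hX B C B.2 C.2
    (Subtype.coe_injective.ne hBC)
  exact ⟨x, hxX, by simp only [height]; omega⟩

theorem exists_height_inl_ne_inr (hG : G.IsBlockGraph) {X : Finset V}
    (hX : G.IsNonlocalResolvingSet X) (B : {B : Set V // G.IsBlock B})
    (c : {v : V // G.IsCutVertex v}) : ∃ x ∈ X, height G x (.inl B) ≠ height G x (.inr c) := by
  obtain ⟨C, hC, hCB, -⟩ := exists_isBlock_ne_of_isCutVertex hG.1.preconnected c.2 B.2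
  obtain ⟨x, hxX, -⟩ := exists_height_inl_ne hG hX (B := ⟨C, hC⟩) (Subtype.coe_ne_coe.1 hCB)
  exact ⟨x, hxX, by simp only [height]; omega⟩

theorem resolves_of_isCutVertex (hG : G.IsBlockGraph) {X : Finset V}
    (hX : G.IsNonlocalResolvingSet X) {c d : V} (hc : G.IsCutVertex c) (hd : G.IsCutVertex d)
    (hcd : c ≠ d) : G.Resolves X c d := by
  by_cases hadj : G.Adj c d
  swap
  · exact hX c d hcd hadj
  obtain ⟨B, hB, hcB, hdB⟩ := exists_isBlock_of_adj hadj
  obtain ⟨C, hC, hCB, hcC⟩ := exists_isBlock_ne_of_isCutVertex hG.1.preconnected hc hB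
  obtain ⟨D, hD, hDB, hdD⟩ := exists_isBlock_ne_of_isCutVertex hG.1.preconnected hd hB
  have hCD : C ≠ D := by
    rintro rfl
    exact hCB (eq_of_isBlock_of_inter_nontrivial hC hB ⟨c, ⟨hcC, hcB⟩, d, ⟨hdD, hdB⟩, hcd⟩)
  obtain ⟨x, hxX, hx⟩ :=
    (isNonlocalResolvingSet_iff_forall_isBlock hG).1 hX C D hC hD hCD
  refine ⟨x, hxX, fun heq => hx ?_⟩
  have gate_ne {a b : V} (hbB : b ∈ B) (hab : a ≠ b) (heq : G.dist a x = G.dist b x) :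
      gate G B x ≠ a := by
    intro hgate
    have := dist_of_mem_of_gate_ne hG hB hbB (x := x) (hgate.trans_ne hab)
    rw [hgate] at this
    omega
  rw [gate_eq_of_gate_ne hG hB hC hCB.symm hcB hcC (gate_ne hdB hcd heq),
    gate_eq_of_gate_ne hG hB hD hDB.symm hdB hdD (gate_ne hcB hcd.symm heq.symm), heq]

theorem exists_height_ne (hG : G.IsBlockGraph) {X : Finset V} (hX : G.IsNonlocalResolvingSet X)
    {s t : TreeVertex G} (hst : s ≠ t) : ∃ x ∈ X, height G x s ≠ height G x t := by
  match s, t, hst with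
  | .inl B, .inl C, hBC => exact exists_height_inl_ne hG hX (Sum.inl_injective.ne_iff.1 hBC)
  | .inl B, .inr c, _ => exact exists_height_inl_ne_inr hG hX B c
  | .inr c, .inl B, _ => simpa only [ne_comm] using exists_height_inl_ne_inr hG hX B c
  | .inr c, .inr d, hcd =>
    obtain ⟨x, hxX, hx⟩ := resolves_of_isCutVertex hG hX c.2 d.2
      (Subtype.coe_injective.ne (Sum.inr_injective.ne_iff.1 hcd))
    exact ⟨x, hxX, by simp only [height]; omega⟩

theorem isNonlocalResolvingSet_iff_isResolvingSet_image [DecidableEq (TreeVertex G)]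
    (hG : G.IsBlockGraph) {X : Finset V} :
    G.IsNonlocalResolvingSet X ↔ G.blockCutpointTree.IsResolvingSet (X.image (toTree G)) := by
  simp only [IsResolvingSet, Resolves, Finset.exists_mem_image, ne_eq, dist_toTree_eq_iff hG]
  refine ⟨fun hX s t hst => exists_height_ne hG hX hst, fun hX => ?_⟩
  refine (isNonlocalResolvingSet_iff_forall_isBlock hG).2 fun B C hB hC hBC => ?_
  obtain ⟨x, hxX, hx⟩ := hX (.inl ⟨B, hB⟩) (.inl ⟨C, hC⟩) (by simpa using hBC)
  exact ⟨x, hxX, fun heq => hx (by simp only [height, heq])⟩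

theorem neighborSet_of_notMem_range_toTree (hG : G.IsBlockGraph) {t : TreeVertex G}
    (ht : t ∉ Set.range (toTree G)) :
    (G.blockCutpointTree.neighborSet t).Nontrivial ∧
      G.blockCutpointTree.neighborSet t ⊆ Set.range (toTree G) := by
  have inr_mem (c : {v : V // G.IsCutVertex v}) : .inr c ∈ Set.range (toTree G) :=
    ⟨c.1, toTree_of_isCutVertex c.2⟩
  obtain B | c := t
  swap
  · exact absurd (inr_mem c) ht
  have hcut {v : V} (hv : v ∈ B.1) : G.IsCutVertex v := by
    by_contra hcut
    exact ht ⟨v, toTree_of_not_isCutVertex hG hcut B.2 hv⟩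
  obtain ⟨a, ha⟩ := nonempty_of_isBlock B.2
  obtain ⟨C, hC, hCB, -⟩ := exists_isBlock_ne_of_isCutVertex hG.1.preconnected (hcut ha) B.2
  have : Nontrivial V := nontrivial_of_isBlock_ne hC B.2 hCB
  obtain ⟨b, hb, hba⟩ := (nontrivial_of_isBlock hG.1.preconnected B.2).exists_ne a
  refine ⟨⟨.inr ⟨a, hcut ha⟩, ha, .inr ⟨b, hcut hb⟩, hb, by simpa using hba.symm⟩, ?_⟩
  rintro (D | d) hd
  · exact hd.elim
  · exact inr_mem d

theorem exists_isResolvingSet_image_toTree [DecidableEq (TreeVertex G)] (hG : G.IsBlockGraph)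
    {Y : Finset (TreeVertex G)} (hY : G.blockCutpointTree.IsResolvingSet Y) :
    ∃ X : Finset V, X.card ≤ Y.card ∧
      G.blockCutpointTree.IsResolvingSet (X.image (toTree G)) := by
  obtain ⟨Z, hZrange, hZY, hZ⟩ := exists_isResolvingSet_subset (isTree_blockCutpointTree hG)
    (fun _ => neighborSet_of_notMem_range_toTree hG) hY
  rw [← Set.image_univ] at hZrange
  obtain ⟨X, -, hinj, rfl⟩ := Finset.exists_subset_injOn_image_eq_of_surjOn _ _ hZrange
  exact ⟨X, (Finset.card_image_of_injOn hinj).symm.trans_le hZY, hZ⟩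

theorem metricDim_le {X : Finset V} (hX : G.IsResolvingSet X) : G.metricDim ≤ X.card :=
  Nat.sInf_le ⟨X, rfl, hX⟩

theorem nonlocalMetricDim_le {X : Finset V} (hX : G.IsNonlocalResolvingSet X) :
    G.nonlocalMetricDim ≤ X.card :=
  Nat.sInf_le ⟨X, rfl, hX⟩

theorem exists_card_eq_metricDim {X : Finset V} (hX : G.IsResolvingSet X) :
    ∃ Y : Finset V, Y.card = G.metricDim ∧ G.IsResolvingSet Y :=
  Nat.sInf_mem (s := {k | ∃ Y : Finset V, Y.card = k ∧ G.IsResolvingSet Y}) ⟨_, X, rfl, hX⟩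

theorem exists_card_eq_nonlocalMetricDim {X : Finset V} (hX : G.IsNonlocalResolvingSet X) :
    ∃ Y : Finset V, Y.card = G.nonlocalMetricDim ∧ G.IsNonlocalResolvingSet Y :=
  Nat.sInf_mem (s := {k | ∃ Y : Finset V, Y.card = k ∧ G.IsNonlocalResolvingSet Y}) ⟨_, X, rfl, hX⟩

theorem isNonlocalResolvingSet_univ [Fintype V] (hG : G.Connected) :
    G.IsNonlocalResolvingSet Finset.univ := by
  refine fun u v huv _ => ⟨u, Finset.mem_univ u, ?_⟩
  rw [dist_self]
  exact (hG.pos_dist_of_ne huv.symm).ne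

end BlockGraph

open BlockGraph in
theorem mainTheorem2_general {V : Type*} (G : SimpleGraph V) (hG : G.IsBlockGraph)
    (hfinite : ∃ X : Finset V, G.IsNonlocalResolvingSet X) :
    G.nonlocalMetricDim = G.blockCutpointTree.metricDim := by
  classical
  obtain ⟨X, hXcard, hX⟩ := exists_card_eq_nonlocalMetricDim hfinite.choose_spec
  rw [isNonlocalResolvingSet_iff_isResolvingSet_image hG] at hX
  obtain ⟨Y, hYcard, hY⟩ := exists_card_eq_metricDim hX
  obtain ⟨Z, hZcard, hZ⟩ := exists_isResolvingSet_image_toTree hG hY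
  rw [← isNonlocalResolvingSet_iff_isResolvingSet_image hG] at hZ
  apply le_antisymm
  · calc G.nonlocalMetricDim ≤ Z.card := nonlocalMetricDim_le hZ
      _ ≤ Y.card := hZcard
      _ = G.blockCutpointTree.metricDim := hYcard
  · calc G.blockCutpointTree.metricDim ≤ (X.image (toTree G)).card := metricDim_le hX
      _ ≤ X.card := Finset.card_image_le
      _ = G.nonlocalMetricDim := hXcard

theorem mainTheorem2 {V : Type*} [Fintype V] (G : SimpleGraph V)
    (hG : G.IsBlockGraph) (hn : 3 ≤ Fintype.card V) :
    G.nonlocalMetricDim = G.blockCutpointTree.metricDim :=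
  mainTheorem2_general G hG ⟨_, BlockGraph.isNonlocalResolvingSet_univ hG.1⟩
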